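/- Let $p$ be a prime, let $R=\mathbb F_p[t,t^{-1}]$, let $f\mapsto\overline f$ be the involution $\overline{f}(t)=f(t^{-1})$ of $R$ (applied entrywise to matrices), and put $\Phi=1+t^{-1}+t$. Square brackets denote classes in a projective linear group. Let $\mathcal B_p$ be the group of all $A\in\mathrm{GL}(3,R)$ with $$(t,t^2,t^3)\,A=(t,t^2,t^3),\qquad A\begin{pmatrix}1\\1\\1\end{pmatrix}=\begin{pmatrix}1\\1\\1\end{pmatrix},\qquad \overline A\,J_3\,A^{T}=J_3,\qquad J_3=\begin{pmatrix}1&-t^{-1}&-t^{-1}\\-t&1&-t^{-1}\\-t&-t&1\end{pmatrix}.$$ Let $$\xi=\begin{pmatrix}t+t^2&0&-1\\-1&t&-1\\-1&-1&-1\end{pmatrix},\qquad g_{kl}(A)=\frac{(A\xi)_{kl}}{t(1+t)}\quad(1\le k,l\le 2),$$ let $\phi_p:\mathcal B_p\to\mathrm{GL}(2,\mathbb F_p(t))$ be the group homomorphism $$\phi_p(A)=\begin{pmatrix}g_{11}&g_{12}\\ t^{-1}g_{11}+(1+t)g_{21}& t^{-1}g_{12}+(1+t)g_{22}\end{pmatrix},$$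 and let $\overline{\phi_p}:\mathcal B_p\to\mathrm{PGL}(2,\mathbb F_p(t))$ be its composition with the natural projection. Regard $\mathrm{PGL}(2,R)$ as a subgroup of $\mathrm{PGL}(2,\mathbb F_p(t))$. The quaternionic group $\mathcal Q_p$ is the subgroup of those elements of $\mathrm{PGL}(2,R)$ that have a representative in $\mathrm{GL}(2,R)$ of the form $\begin{pmatrix}g_1&g_2\\-\Phi\,\overline{g_2}&\overline{g_1}\end{pmatrix}$ with $g_1,g_2\in R$, and $\mathcal Q_p^1\le\mathcal Q_p$ is the subgroup of the elements that have a representative in $\mathrm{GL}(2,R)$ of determinant $1$. The Laurent image subgroup is $I_p=\overline{\phi_p}(\mathcal B_p)\cap\mathrm{PGL}(2,R)$, and $I_p^1=I_p\cap\mathcal Q_p^1$. **Theorem.** If $p\le 7$, then $\mathcal Q_p^1=I_p^1$. If $p>7$, then the index $[\mathcal Q_p^1:I_p^1]$ is finite and $$2\le[\mathcal Q_p^1:I_p^1]\le\frac{p-\left(\frac{-3}{p}\right)}{6},$$ where $\left(\frac{\cdot}{p}\right)$ is the Legendre symbol. -/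

import Mathlib

open scoped LaurentPolynomial MatrixGroups

noncomputable section

namespace BurauMod

/-- The ring `𝔽_p[t, t⁻¹]` of Laurent polynomials. -/
abbrev LRing (p : ℕ) : Type := (ZMod p)[T;T⁻¹]

/-- The field `𝔽_p(t)`, as the field of fractions of `𝔽_p[t, t⁻¹]`. -/
abbrev LField (p : ℕ) : Type := FractionRing (LRing p)

/-- The variable `t`. -/
def t (p : ℕ) : LRing p := LaurentPolynomial.T 1

/-- The inverse `t⁻¹` of the variable. -/
def tinv (p : ℕ) : LRing p := LaurentPolynomial.T (-1)

/-- The involution `f(t) ↦ f(t⁻¹)` of `𝔽_p[t, t⁻¹]`. -/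
def bar (p : ℕ) : LRing p →+* LRing p :=
  (LaurentPolynomial.invert : LRing p ≃ₐ[ZMod p] LRing p).toRingEquiv.toRingHom

lemma t_mul_tinv (p : ℕ) : t p * tinv p = 1 := by
  rw [t, tinv, ← LaurentPolynomial.T_add]; simp

@[simp] lemma bar_t (p : ℕ) : bar p (t p) = tinv p := by
  simp [bar, t, tinv]

@[simp] lemma bar_tinv (p : ℕ) : bar p (tinv p) = t p := by
  simp [bar, t, tinv]

@[simp] lemma bar_bar (p : ℕ) (f : LRing p) : bar p (bar p f) = f := by
  simpa [bar] using LaurentPolynomial.involutive_invert f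

/-- Squier's form `J₃`. -/
def J (p : ℕ) : Matrix (Fin 3) (Fin 3) (LRing p) :=
  !![1, -tinv p, -tinv p; -t p, 1, -tinv p; -t p, -t p, 1]

/-- The row vector `v = (t, t², t³)`. -/
def v (p : ℕ) : Fin 3 → LRing p := ![t p, t p ^ 2, t p ^ 3]

/-- The formal Burau group `𝓑_p`: all `A ∈ GL(3, 𝔽_p[t, t⁻¹])` that fix the row vector
`(t, t², t³)` and the column vector `(1, 1, 1)ᵀ` and satisfy the unitarity relation
`Ā J₃ Aᵀ = J₃`. -/
def formalBurau (p : ℕ) : Subgroup (GL (Fin 3) (LRing p)) where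
  carrier := {A | Matrix.vecMul (v p) A.val = v p ∧ Matrix.mulVec A.val 1 = 1 ∧
    A.val.map (bar p) * J p * A.val.transpose = J p}
  one_mem' := by
    refine ⟨by simp, by simp, ?_⟩
    simp [Matrix.map_one]
  mul_mem' := by
    rintro A B ⟨hA1, hA2, hA3⟩ ⟨hB1, hB2, hB3⟩
    refine ⟨?_, ?_, ?_⟩
    · rw [Units.val_mul, ← Matrix.vecMul_vecMul, hA1, hB1]
    · rw [Units.val_mul, ← Matrix.mulVec_mulVec, hB2, hA2]
    · rw [Units.val_mul, Matrix.map_mul, Matrix.transpose_mul]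
      calc A.val.map (bar p) * B.val.map (bar p) * J p * (B.val.transpose * A.val.transpose)
          = A.val.map (bar p) * (B.val.map (bar p) * J p * B.val.transpose) *
              A.val.transpose := by simp only [Matrix.mul_assoc]
        _ = J p := by rw [hB3, hA3]
  inv_mem' := by
    rintro A ⟨hA1, hA2, hA3⟩
    have h1 : A.val * (A⁻¹).val = 1 := A.mul_inv
    have h2 : (A⁻¹).val * A.val = 1 := A.inv_mul
    refine ⟨?_, ?_, ?_⟩
    · conv_lhs => rw [← hA1]
      rw [Matrix.vecMul_vecMul, h1, Matrix.vecMul_one]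
    · conv_lhs => rw [← hA2]
      rw [Matrix.mulVec_mulVec, h2, Matrix.one_mulVec]
    · have h3 : (A⁻¹).val.map (bar p) * A.val.map (bar p) = 1 := by
        rw [← Matrix.map_mul, h2, Matrix.map_one _ (map_zero _) (map_one _)]
      have h4 : A.val.transpose * (A⁻¹).val.transpose = 1 := by
        rw [← Matrix.transpose_mul, h2, Matrix.transpose_one]
      conv_lhs => rw [← hA3]
      calc (A⁻¹).val.map (bar p) * (A.val.map (bar p) * J p * A.val.transpose) *
            (A⁻¹).val.transpose
          = ((A⁻¹).val.map (bar p) * A.val.map (bar p)) * J p *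
              (A.val.transpose * (A⁻¹).val.transpose) := by simp only [Matrix.mul_assoc]
        _ = J p := by rw [h3, h4, Matrix.one_mul, Matrix.mul_one]

/-- The matrix `ξ`. -/
def xi (p : ℕ) : Matrix (Fin 3) (Fin 3) (LRing p) :=
  !![t p + t p ^ 2, 0, -1; -1, t p, -1; -1, -1, -1]

section

variable (p : ℕ) [Fact p.Prime]

/-- The variable `t` in the field `𝔽_p(t)`. -/
def tK : LField p := algebraMap (LRing p) (LField p) (t p)

/-- The entries `g_{kl} = f_{kl} / (t (1 + t)) ∈ 𝔽_p(t)`, where `f_{kl} = (A ξ)_{kl}`. -/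
def gEntry (A : Matrix (Fin 3) (Fin 3) (LRing p)) (k l : Fin 3) : LField p :=
  algebraMap (LRing p) (LField p) ((A * xi p) k l) / (tK p * (1 + tK p))

/-- The matrix of the first homomorphism `φ_p`. -/
def phiMat (A : Matrix (Fin 3) (Fin 3) (LRing p)) : Matrix (Fin 2) (Fin 2) (LField p) :=
  !![gEntry p A 0 0, gEntry p A 0 1;
     (tK p)⁻¹ * gEntry p A 0 0 + (1 + tK p) * gEntry p A 1 0,
     (tK p)⁻¹ * gEntry p A 0 1 + (1 + tK p) * gEntry p A 1 1]

lemma tK_ne_zero : tK p ≠ 0 := by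
  intro h
  have h1 := congrArg (algebraMap (LRing p) (LField p)) (t_mul_tinv p)
  rw [map_mul, map_one] at h1
  rw [tK] at h
  rw [h, zero_mul] at h1
  exact zero_ne_one h1

lemma one_add_tK_ne_zero : 1 + tK p ≠ 0 := by
  intro h
  have h1 : algebraMap (LRing p) (LField p) (1 + t p) = 0 := by
    rw [map_add, map_one]; exact h
  have h2 : (1 + t p : LRing p) = 0 :=
    (map_eq_zero_iff _ (IsFractionRing.injective (LRing p) (LField p))).1 h1
  have h3 := congrArg (fun f : LRing p => f.coeff 0) h2
  simp [t] at h3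

lemma map_t : algebraMap (LRing p) (LField p) (t p) = tK p := rfl

lemma phiMat_one : phiMat p 1 = 1 := by
  have h1 := tK_ne_zero p
  have h2 := one_add_tK_ne_zero p
  ext i j
  fin_cases i <;> fin_cases j <;> simp [phiMat, gEntry, xi, map_t] <;> field_simp
  all_goals ring

lemma phiMat_mul (A B : Matrix (Fin 3) (Fin 3) (LRing p))
    (hA : Matrix.mulVec A 1 = 1) (hB : Matrix.vecMul (v p) B = v p) :
    phiMat p (A * B) = phiMat p A * phiMat p B := by
  have h1 := tK_ne_zero p
  have h2 := one_add_tK_ne_zero p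
  have hF : ∀ l : Fin 3, l ≠ 2 →
      t p * (B * xi p) 0 l + t p ^ 2 * (B * xi p) 1 l + t p ^ 3 * (B * xi p) 2 l = 0 := by
    intro l hl
    have h : Matrix.vecMul (v p) (B * xi p) l = Matrix.vecMul (v p) (xi p) l := by
      rw [← Matrix.vecMul_vecMul, hB]
    have h' : Matrix.vecMul (v p) (xi p) l = 0 := by
      fin_cases l
      · simp [v, xi, Matrix.vecMul, dotProduct, Fin.sum_univ_three]; ring
      · simp [v, xi, Matrix.vecMul, dotProduct, Fin.sum_univ_three]; ring
      · exact absurd rfl hl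
    rw [h'] at h
    simpa [v, Matrix.vecMul, dotProduct, Fin.sum_univ_three] using h
  have hA' : ∀ k : Fin 3, A k 2 = 1 - A k 0 - A k 1 := by
    intro k
    have h := congrFun hA k
    simp only [Matrix.mulVec, dotProduct, Fin.sum_univ_three, Pi.one_apply, mul_one] at h
    rw [← h]; ring
  have hG : ∀ l : Fin 3, l ≠ 2 → algebraMap (LRing p) (LField p) ((B * xi p) 2 l) =
      -(algebraMap (LRing p) (LField p) ((B * xi p) 0 l) +
        tK p * algebraMap (LRing p) (LField p) ((B * xi p) 1 l)) / tK p ^ 2 := by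
    intro l hl
    have h := congrArg (algebraMap (LRing p) (LField p)) (hF l hl)
    simp only [map_add, map_mul, map_pow, map_zero, map_t] at h
    rw [eq_div_iff (pow_ne_zero 2 h1)]
    apply mul_left_cancel₀ h1
    linear_combination h
  have hAB : ∀ k l : Fin 3, (A * B * xi p) k l = A k 0 * (B * xi p) 0 l +
      A k 1 * (B * xi p) 1 l + (1 - A k 0 - A k 1) * (B * xi p) 2 l := by
    intro k l
    rw [Matrix.mul_assoc, Matrix.mul_apply, Fin.sum_univ_three, hA']
  have hx0 : ∀ k : Fin 3, (A * xi p) k 0 = A k 0 * (1 + t p + t p ^ 2) - 1 := by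
    intro k
    rw [Matrix.mul_apply, Fin.sum_univ_three, hA']
    simp [xi]; ring
  have hx1 : ∀ k : Fin 3, (A * xi p) k 1 = A k 0 + A k 1 * (1 + t p) - 1 := by
    intro k
    rw [Matrix.mul_apply, Fin.sum_univ_three, hA']
    simp [xi]; ring
  have hG0 := hG 0 (by decide)
  have hG1 := hG 1 (by decide)
  clear hF hG
  unfold phiMat gEntry
  generalize B * xi p = F at *
  ext i j
  fin_cases i <;> fin_cases j <;>
    simp only [hAB, hx0, hx1, Matrix.mul_apply (n := Fin 2) (m := Fin 2), Fin.sum_univ_two, Matrix.of_apply,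
      Matrix.cons_val', Matrix.cons_val_zero, Matrix.cons_val_one, Matrix.cons_val_fin_one,
      Fin.zero_eta, Fin.mk_one, map_add, map_sub, map_mul, map_one, map_pow, map_t, hG0, hG1] <;>
    field_simp <;> ring

/-- The first homomorphism `φ_p : 𝓑_p → GL(2, 𝔽_p(t))`, sending `A` to the matrix `phiMat p A`. -/
def phi : formalBurau p →* GL (Fin 2) (LField p) :=
  MonoidHom.toHomUnits
    { toFun := fun A => phiMat p A.val.val
      map_one' := phiMat_one p
      map_mul' := fun A B => phiMat_mul p A.val.val B.val.val A.property.2.1 B.property.1 }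

lemma phi_val (A : formalBurau p) : (phi p A).val = phiMat p A.val.val := rfl

/-- The composition `φ̄_p` of `φ_p` with the projection `π_p : GL(2, 𝔽_p(t)) → PGL(2, 𝔽_p(t))`. -/
def phiBar : formalBurau p →* PGL(2, LField p) :=
  Matrix.ProjGenLinGroup.mk.comp (phi p)

/-- The natural map `PGL(2, 𝔽_p[t, t⁻¹]) → PGL(2, 𝔽_p(t))` (which is injective). -/
def inclusion : PGL(2, LRing p) →* PGL(2, LField p) :=
  Matrix.ProjGenLinGroup.map (algebraMap (LRing p) (LField p))

end

/-- The Laurent polynomial `Φ = 1 + t⁻¹ + t`. -/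
def Phi (p : ℕ) : LRing p := 1 + tinv p + t p

lemma bar_Phi (p : ℕ) : bar p (Phi p) = Phi p := by
  simp only [Phi, map_add, map_one, bar_t, bar_tinv]; ring

/-- The matrix `B` has the form `(g₁, g₂; -Φ ḡ₂, ḡ₁)`. -/
def IsQuaternionic (p : ℕ) (B : Matrix (Fin 2) (Fin 2) (LRing p)) : Prop :=
  ∃ g₁ g₂ : LRing p, B = !![g₁, g₂; -Phi p * bar p g₂, bar p g₁]

lemma IsQuaternionic.mul {p : ℕ} {A B : Matrix (Fin 2) (Fin 2) (LRing p)}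
    (hA : IsQuaternionic p A) (hB : IsQuaternionic p B) : IsQuaternionic p (A * B) := by
  obtain ⟨a, b, rfl⟩ := hA
  obtain ⟨c, d, rfl⟩ := hB
  refine ⟨a * c + b * (-Phi p * bar p d), a * d + b * bar p c, ?_⟩
  apply Matrix.ext
  intro i j
  fin_cases i <;> fin_cases j <;>
    simp [Matrix.mul_apply, Fin.sum_univ_two, bar_Phi] <;> ring

lemma IsQuaternionic.inv {p : ℕ} {B : GL (Fin 2) (LRing p)}
    (hB : IsQuaternionic p B.val) : IsQuaternionic p (B⁻¹).val := by
  obtain ⟨a, b, h⟩ := hB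
  have hdet : B.val.det = a * bar p a + Phi p * b * bar p b := by
    rw [h, Matrix.det_fin_two]
    simp; ring
  have hbar : bar p B.val.det = B.val.det := by
    rw [hdet]; simp [bar_Phi]; ring
  obtain ⟨u, hu⟩ : IsUnit B.val.det := (Matrix.isUnit_iff_isUnit_det _).1 B.isUnit
  have hub : bar p ((u⁻¹ : (LRing p)ˣ) : LRing p) = ((u⁻¹ : (LRing p)ˣ) : LRing p) := by
    have e1 : bar p ((u⁻¹ : (LRing p)ˣ) : LRing p) * B.val.det = 1 := by
      rw [← hbar, ← map_mul, ← hu, Units.inv_mul, map_one]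
    rw [← hu, mul_comm] at e1
    exact Units.eq_inv_of_mul_eq_one_left e1
  refine ⟨(u⁻¹ : (LRing p)ˣ) * bar p a, -((u⁻¹ : (LRing p)ˣ) * b), ?_⟩
  rw [Matrix.coe_units_inv, Matrix.inv_def, ← hu, Ring.inverse_unit, h, Matrix.adjugate_fin_two]
  apply Matrix.ext
  intro i j
  fin_cases i <;> fin_cases j <;> simp [hub] <;> ring

/-- The quaternionic group `𝓠_p`: the elements of `PGL(2, 𝔽_p[t, t⁻¹])` that have a representative
of the form `(g₁, g₂; -Φ ḡ₂, ḡ₁)` in `GL(2, 𝔽_p[t, t⁻¹])`. -/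
def quaternionicGroup (p : ℕ) : Subgroup PGL(2, LRing p) where
  carrier := {M | ∃ B : GL (Fin 2) (LRing p),
    Matrix.ProjGenLinGroup.mk B = M ∧ IsQuaternionic p B.val}
  one_mem' := ⟨1, map_one _, 1, 0, by
    apply Matrix.ext; intro i j; fin_cases i <;> fin_cases j <;> simp⟩
  mul_mem' := by
    rintro _ _ ⟨A, rfl, hA⟩ ⟨B, rfl, hB⟩
    exact ⟨A * B, map_mul _ _ _, hA.mul hB⟩
  inv_mem' := by
    rintro _ ⟨B, rfl, hB⟩
    exact ⟨B⁻¹, map_inv _ _, hB.inv⟩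

/-- The determinant-one subgroup `𝓠_p¹`: the elements of `𝓠_p` that have a representative
of determinant `1`. -/
def quaternionicGroupOne (p : ℕ) : Subgroup PGL(2, LRing p) where
  carrier := {M | M ∈ quaternionicGroup p ∧ ∃ B : GL (Fin 2) (LRing p),
    Matrix.ProjGenLinGroup.mk B = M ∧ B.val.det = 1}
  one_mem' := ⟨one_mem _, 1, map_one _, by simp⟩
  mul_mem' := by
    rintro _ _ ⟨hA, A, rfl, hA'⟩ ⟨hB, B, rfl, hB'⟩
    exact ⟨mul_mem hA hB, A * B, map_mul _ _ _, by
      rw [Units.val_mul, Matrix.det_mul, hA', hB', one_mul]⟩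
  inv_mem' := by
    rintro _ ⟨hB, B, rfl, hB'⟩
    refine ⟨inv_mem hB, B⁻¹, map_inv _ _, ?_⟩
    rw [Matrix.coe_units_inv, Matrix.det_nonsing_inv, hB', Ring.inverse_one]

/-- The Laurent image subgroup `I_p = φ̄_p(𝓑_p) ∩ PGL(2, 𝔽_p[t, t⁻¹])`, as a subgroup of
`PGL(2, 𝔽_p[t, t⁻¹])`. -/
def laurentImage (p : ℕ) [Fact p.Prime] : Subgroup PGL(2, LRing p) :=
  (phiBar p).range.comap (inclusion p)

/-- The subgroup `I_p¹ = I_p ∩ 𝓠_p¹`. -/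
def laurentImageOne (p : ℕ) [Fact p.Prime] : Subgroup PGL(2, LRing p) :=
  laurentImage p ⊓ quaternionicGroupOne p

end BurauMod

end

/-!
A unit of `𝔽_p[t, t⁻¹]` that is invariant under `t ↦ t⁻¹` is a constant, so the quaternionic group of
determinant one is the image in `PGL(2)` of the group of pairs `(g₁, g₂)` with
`g₁ ḡ₁ + Φ g₂ ḡ₂ = 1`, realised here as `quaternionicSL`. Modulo `Φ` these matrices are upper
triangular, the variable `t` becomes a cube root of unity `ω` and the involution becomes conjugation;
hence `g₁ ↦ g₁ mod Φ` is a homomorphism `reduction` to the norm-one group of `𝔽_p[ω]`.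

A Burau matrix `A` is conjugate through `ξ` to `diag(φ(A), 1)`, and `Φ J₃ = ξ̄ diag(1, Φ, -1) ξᵀ`, so
that the unitarity relation for `A` says that `φ(A)` is unitary for `diag(1, Φ)`. Conversely
`ξ diag(M, 1) ξ⁻¹` is integral under congruences at the two factors `Φ` and `1 + t` of `det ξ`. For a
unit multiple `M = u B` of a quaternionic matrix the one at `1 + t` is automatic, because the
involution is trivial at `t = -1`, and those at `Φ` reduce to `u g₁ ≡ 1`. If `u B = φ(A)`, then
`u² = det A` shows that `u` is a unit `a tᵏ`, and taking norms gives `a = ± 1`. So `B` gives an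
element of the Laurent image exactly if its reduction is `± ωᵏ`
(`toQuaternionicGroupOne_mem_laurentImage_iff`), and the index of the theorem is the index of
`{± ωᵏ}` in the image of `reduction` (`relIndex_laurentImageOne`).

For `p ≤ 7` the norm-one group equals `{± ωᵏ}`. For `p > 3` the set `{± ωᵏ}` has six elements, while
the norm-one group has at most `p - (-3/p)` by the rational parametrization of the conic
`a² - ab + b² = 1` (`card_normOne_le`); this is the upper bound. The lower bound comes from one
explicit matrix (`exists_reduction_notMem_sixthRoots`).
-/

noncomputable section

namespace BurauMod

/-! ### Laurent polynomials -/

section Laurent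

variable (p : ℕ)

@[simp] lemma bar_C (a : ZMod p) : bar p (LaurentPolynomial.C a) = LaurentPolynomial.C a := by
  simp [bar]

/-- Laurent polynomials are generated from the constants by addition and multiplication by `t`
and `t⁻¹`. -/
lemma induction_t {p : ℕ} {P : LRing p → Prop} (f : LRing p)
    (hC : ∀ a, P (LaurentPolynomial.C a)) (hadd : ∀ f g, P f → P g → P (f + g))
    (ht : ∀ f, P f → P (t p * f)) (htinv : ∀ f, P f → P (tinv p * f)) : P f := by
  refine LaurentPolynomial.induction_on f hC (hadd _ _) ?_ ?_
  · intro n a h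
    have e : (LaurentPolynomial.C a * LaurentPolynomial.T (n + 1) : LRing p) =
        t p * (LaurentPolynomial.C a * LaurentPolynomial.T n) := by
      rw [t, LaurentPolynomial.T_add]; ring
    rw [e]; exact ht _ h
  · intro n a h
    have e : (LaurentPolynomial.C a * LaurentPolynomial.T (-n - 1) : LRing p) =
        tinv p * (LaurentPolynomial.C a * LaurentPolynomial.T (-n)) := by
      rw [tinv, sub_eq_add_neg, LaurentPolynomial.T_add]; ring
    rw [e]; exact htinv _ h

/-- At `t = -1` the involution is trivial. -/
lemma one_add_t_dvd_sub_bar (f : LRing p) : 1 + t p ∣ f - bar p f := by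
  have key := t_mul_tinv p
  induction f using induction_t with
  | hC a => simp
  | hadd f g hf hg =>
    rw [map_add, add_sub_add_comm]; exact dvd_add hf hg
  | ht f hf =>
    have e : t p * f - bar p (t p * f) =
        t p * (f - bar p f) + (1 + t p) * ((1 - tinv p) * bar p f) := by
      rw [map_mul, bar_t]; linear_combination bar p f * key
    rw [e]; exact dvd_add (hf.mul_left _) (dvd_mul_right _ _)
  | htinv f hf =>
    have e : tinv p * f - bar p (tinv p * f) =
        tinv p * (f - bar p f) - (1 + t p) * ((1 - tinv p) * bar p f) := by
      rw [map_mul, bar_tinv]; linear_combination -bar p f * key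
    rw [e]; exact dvd_sub (hf.mul_left _) (dvd_mul_right _ _)

variable {p} in
lemma exists_eq_linear_add_Phi_mul (f : LRing p) :
    ∃ (a b : ZMod p) (h : LRing p),
      f = LaurentPolynomial.C a + LaurentPolynomial.C b * t p + Phi p * h := by
  have key := t_mul_tinv p
  induction f using induction_t with
  | hC a => exact ⟨a, 0, 0, by simp⟩
  | hadd f g hf hg =>
    obtain ⟨a, b, h, rfl⟩ := hf
    obtain ⟨c, d, k, rfl⟩ := hg
    exact ⟨a + c, b + d, h + k, by simp only [map_add]; ring⟩
  | ht f hf =>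
    obtain ⟨a, b, h, rfl⟩ := hf
    refine ⟨-b, a - b, t p * h + t p * LaurentPolynomial.C b, ?_⟩
    simp only [map_sub, map_neg, Phi]
    linear_combination -LaurentPolynomial.C b * key
  | htinv f hf =>
    obtain ⟨a, b, h, rfl⟩ := hf
    refine ⟨b - a, -a, tinv p * h + LaurentPolynomial.C a, ?_⟩
    simp only [map_sub, map_neg, Phi]
    linear_combination LaurentPolynomial.C b * key

variable [Fact p.Prime]

instance : IsIntegrallyClosed (LRing p) :=
  isIntegrallyClosed_of_isLocalization (R := Polynomial (ZMod p)) _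
    (Submonoid.powers (Polynomial.X : Polynomial (ZMod p)))
    (powers_le_nonZeroDivisors_of_noZeroDivisors Polynomial.X_ne_zero)

variable {p} in
lemma exists_eq_C_mul_T_of_isUnit {u : LRing p} (hu : IsUnit u) :
    ∃ (a : ZMod p) (n : ℤ), u = LaurentPolynomial.C a * LaurentPolynomial.T n := by
  obtain ⟨v, hv⟩ := hu.exists_right_inv
  obtain ⟨n, f, hf⟩ := LaurentPolynomial.exists_T_pow u
  obtain ⟨m, g, hg⟩ := LaurentPolynomial.exists_T_pow v
  have hfg : f * g = Polynomial.X ^ (n + m) := by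
    apply Polynomial.toLaurent_injective
    rw [map_mul, hf, hg, Polynomial.toLaurent_X_pow, Nat.cast_add, LaurentPolynomial.T_add]
    linear_combination (LaurentPolynomial.T n * LaurentPolynomial.T m) * hv
  obtain ⟨j, -, hj⟩ := (dvd_prime_pow Polynomial.prime_X _).1 (Dvd.intro _ hfg)
  obtain ⟨w, hw⟩ := hj.symm
  obtain ⟨a, -, ha⟩ := Polynomial.isUnit_iff.1 w.isUnit
  refine ⟨a, j - n, ?_⟩
  have h1 : u * LaurentPolynomial.T n =
      LaurentPolynomial.C a * LaurentPolynomial.T (j : ℤ) := by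
    rw [← hf, ← hw, ← ha, map_mul, Polynomial.toLaurent_X_pow, Polynomial.toLaurent_C, mul_comm]
  have h2 : (LaurentPolynomial.T n * LaurentPolynomial.T (-n) : LRing p) = 1 := by
    rw [← LaurentPolynomial.T_add]; simp
  rw [sub_eq_add_neg, LaurentPolynomial.T_add]
  linear_combination LaurentPolynomial.T (-n) * h1 - u * h2

lemma Phi_ne_zero : Phi p ≠ 0 := by
  intro h
  have h3 := congrArg (fun f : LRing p => f.coeff 1) h
  simp [t, tinv, Phi, LaurentPolynomial.T_apply, ← LaurentPolynomial.T_zero] at h3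

lemma one_add_t_ne_zero : 1 + t p ≠ 0 := by
  intro h
  apply one_add_tK_ne_zero p
  rw [← map_t, ← map_one (algebraMap (LRing p) (LField p)), ← map_add, h, map_zero]

lemma t_ne_zero : t p ≠ 0 := left_ne_zero_of_mul_eq_one (t_mul_tinv p)

end Laurent

/-! ### Reduction modulo `Φ` -/

section Reduction

open scoped QuadraticAlgebra

variable (p : ℕ)

/-- The ring `𝔽_p[ω]` with `ω² = -1 - ω`, which is the residue ring `𝔽_p[t, t⁻¹] / (Φ)`. -/
abbrev Eisenstein : Type := QuadraticAlgebra (ZMod p) (-1) (-1)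

/-- The cube root of unity `ω`, as a unit. -/
def omegaUnit : (Eisenstein p)ˣ where
  val := ⟨0, 1⟩
  inv := ⟨-1, -1⟩
  val_inv := by ext <;> simp
  inv_val := by ext <;> simp

/-- Reduction modulo `Φ`, the homomorphism `t ↦ ω`. -/
def ev : LRing p →+* Eisenstein p :=
  LaurentPolynomial.eval₂ (algebraMap (ZMod p) (Eisenstein p)) (omegaUnit p)

@[simp] lemma ev_C (a : ZMod p) : ev p (LaurentPolynomial.C a) = ⟨a, 0⟩ := by
  simp [ev, QuadraticAlgebra.algebraMap_eq]

@[simp] lemma ev_t : ev p (t p) = ⟨0, 1⟩ := by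
  simp [ev, t, omegaUnit]

@[simp] lemma ev_tinv : ev p (tinv p) = ⟨-1, -1⟩ := by
  simp [ev, tinv, omegaUnit]

lemma ev_T (n : ℤ) : ev p (LaurentPolynomial.T n) = ((omegaUnit p ^ n : (Eisenstein p)ˣ) :
    Eisenstein p) := by
  simp [ev]

@[simp] lemma ev_Phi : ev p (Phi p) = 0 := by
  rw [Phi, map_add, map_add, map_one, ev_t, ev_tinv]; ext <;> simp

lemma ev_eq_zero_iff (f : LRing p) : ev p f = 0 ↔ Phi p ∣ f := by
  constructor
  · intro h
    obtain ⟨a, b, k, rfl⟩ := exists_eq_linear_add_Phi_mul f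
    simp only [map_add, map_mul, ev_C, ev_t, ev_Phi, zero_mul, add_zero,
      QuadraticAlgebra.ext_iff] at h
    obtain ⟨h1, h2⟩ := h
    simp at h1 h2
    subst h1 h2
    simp
  · rintro ⟨k, rfl⟩
    simp

/-- Modulo `Φ` the involution becomes conjugation. -/
lemma ev_bar (f : LRing p) : ev p (bar p f) = star (ev p f) := by
  induction f using induction_t with
  | hC a => simp
  | hadd f g hf hg => simp [hf, hg]
  | ht f hf => simp only [map_mul, bar_t, hf, ev_t, ev_tinv, star_mul']; congr 1; ext <;> simp
  | htinv f hf => simp only [map_mul, bar_tinv, hf, ev_t, ev_tinv, star_mul']; congr 1; ext <;> simp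

lemma norm_ev_eq_one {f : LRing p} (h : ev p (f * bar p f) = 1) : (ev p f).norm = 1 := by
  apply QuadraticAlgebra.algebraMap_injective (a := (-1 : ZMod p)) (b := -1)
  rw [QuadraticAlgebra.algebraMap_norm_eq_mul_star, map_one, ← ev_bar, ← map_mul, h]

/-- The group of elements of norm one in `𝔽_p[ω]`. -/
def normOne : Subgroup (Eisenstein p)ˣ :=
  (Units.map (QuadraticAlgebra.norm : Eisenstein p →* ZMod p)).ker

variable {p} in
lemma mem_normOne {x : (Eisenstein p)ˣ} : x ∈ normOne p ↔ (x : Eisenstein p).norm = 1 := by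
  rw [normOne, MonoidHom.mem_ker, Units.ext_iff]; rfl

/-- The group `{± ωᵏ}`, generated by `-ω`. -/
def sixthRoots : Subgroup (Eisenstein p)ˣ := Subgroup.zpowers (-omegaUnit p)

lemma omegaUnit_pow_three : omegaUnit p ^ 3 = 1 := by
  ext <;> simp [omegaUnit, pow_succ]

lemma neg_one_mem_sixthRoots : -1 ∈ sixthRoots p := by
  refine ⟨3, ?_⟩
  change (-omegaUnit p) ^ (3 : ℤ) = -1
  rw [show (3 : ℤ) = (3 : ℕ) from rfl, zpow_natCast, Odd.neg_pow (by decide), omegaUnit_pow_three]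

lemma omegaUnit_mem_sixthRoots : omegaUnit p ∈ sixthRoots p := by
  have h := (sixthRoots p).mul_mem (neg_one_mem_sixthRoots p) (Subgroup.mem_zpowers (-omegaUnit p))
  simpa using h

lemma sixthRoots_le_normOne : sixthRoots p ≤ normOne p := by
  rw [sixthRoots, Subgroup.zpowers_le, mem_normOne]
  simp [omegaUnit, QuadraticAlgebra.norm_def]

end Reduction

/-! ### Burau matrices and their blocks -/

section Block

/-- The `3 × 3` matrix `diag(M, 1)`. -/
def extendOne {S : Type*} [Zero S] [One S] (M : Matrix (Fin 2) (Fin 2) S) :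
    Matrix (Fin 3) (Fin 3) S :=
  !![M 0 0, M 0 1, 0; M 1 0, M 1 1, 0; 0, 0, 1]

lemma det_extendOne {S : Type*} [CommRing S] (M : Matrix (Fin 2) (Fin 2) S) :
    (extendOne M).det = M.det := by
  simp [extendOne, Matrix.det_fin_three, Matrix.det_fin_two]

variable (p : ℕ)

lemma det_xi : (xi p).det = -((1 + t p) * (t p * Phi p)) := by
  have key := t_mul_tinv p
  simp only [xi, Phi, Matrix.det_fin_three, Matrix.of_apply, Matrix.cons_val', Matrix.cons_val_zero,
    Matrix.cons_val_one, Matrix.cons_val]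
  linear_combination (1 + t p) * key

/-- Squier's form is diagonal in the basis of the columns of `ξ`. -/
lemma Phi_smul_J : Phi p • J p =
    (xi p).map (bar p) * Matrix.diagonal ![1, Phi p, -1] * (xi p).transpose := by
  have key := t_mul_tinv p
  refine Matrix.ext fun i j => ?_
  fin_cases i <;> fin_cases j <;>
    simp [J, xi, Phi, Matrix.mul_apply, Fin.sum_univ_three, Matrix.diagonal_apply]
  all_goals grind

variable [Fact p.Prime]

lemma det_xi_ne_zero : (xi p).det ≠ 0 := by
  rw [det_xi]
  exact neg_ne_zero.2 (mul_ne_zero (one_add_t_ne_zero p) (mul_ne_zero (t_ne_zero p) (Phi_ne_zero p)))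

lemma det_J_ne_zero : (J p).det ≠ 0 := by
  have key := t_mul_tinv p
  have e : (J p).det = -(tinv p * (1 + t p) ^ 2) := by
    simp only [J, Matrix.det_fin_three, Matrix.of_apply, Matrix.cons_val', Matrix.cons_val_zero,
      Matrix.cons_val_one, Matrix.cons_val]
    grind
  rw [e]
  exact neg_ne_zero.2 (mul_ne_zero (right_ne_zero_of_mul_eq_one key)
    (pow_ne_zero 2 (one_add_t_ne_zero p)))

variable {p}

/-- The first two columns of `ξ` lie in the kernel of the row vector `v`, and the third one is the fixed
vector `-(1, 1, 1)ᵀ`; in this basis `A` becomes `diag(φ(A), 1)`. -/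
lemma map_mul_map_xi {A : Matrix (Fin 3) (Fin 3) (LRing p)}
    (hv : Matrix.vecMul (v p) A = v p) (h1 : Matrix.mulVec A 1 = 1) :
    (A * xi p).map (algebraMap (LRing p) (LField p)) =
      (xi p).map (algebraMap (LRing p) (LField p)) * extendOne (phiMat p A) := by
  have ht := tK_ne_zero p
  have ht1 := one_add_tK_ne_zero p
  have hF : Matrix.vecMul (v p) (A * xi p) = Matrix.vecMul (v p) (xi p) := by
    rw [← Matrix.vecMul_vecMul, hv]
  have hF' : ∀ l : Fin 3, l ≠ 2 →
      t p * (A * xi p) 0 l + t p ^ 2 * (A * xi p) 1 l + t p ^ 3 * (A * xi p) 2 l = 0 := by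
    intro l hl
    have h := congrFun hF l
    have h' : Matrix.vecMul (v p) (xi p) l = 0 := by
      fin_cases l
      · simp [v, xi, Matrix.vecMul, dotProduct, Fin.sum_univ_three]; ring
      · simp [v, xi, Matrix.vecMul, dotProduct, Fin.sum_univ_three]; ring
      · exact absurd rfl hl
    rw [h'] at h
    simpa [v, Matrix.vecMul, dotProduct, Fin.sum_univ_three] using h
  have hG : ∀ l : Fin 3, l ≠ 2 → algebraMap (LRing p) (LField p) ((A * xi p) 2 l) =
      -(algebraMap (LRing p) (LField p) ((A * xi p) 0 l) +
        tK p * algebraMap (LRing p) (LField p) ((A * xi p) 1 l)) / tK p ^ 2 := by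
    intro l hl
    have h := congrArg (algebraMap (LRing p) (LField p)) (hF' l hl)
    simp only [map_add, map_mul, map_pow, map_zero, map_t] at h
    rw [eq_div_iff (pow_ne_zero 2 ht)]
    apply mul_left_cancel₀ ht
    linear_combination h
  have h2 : ∀ k, (A * xi p) k 2 = -1 := by
    intro k
    have h := congrFun h1 k
    simp only [Matrix.mulVec, dotProduct, Fin.sum_univ_three, Pi.one_apply, mul_one] at h
    simp [Matrix.mul_apply, Fin.sum_univ_three, xi]
    linear_combination -h
  have hG0 := hG 0 (by decide)
  have hG1 := hG 1 (by decide)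
  clear hF hF' hG
  unfold phiMat gEntry
  generalize A * xi p = F at *
  refine Matrix.ext fun i j => ?_
  fin_cases i <;> fin_cases j <;>
    simp [extendOne, Matrix.mul_apply, Fin.sum_univ_three, h2, hG0, hG1, xi, map_t] <;>
    field_simp <;> ring

lemma det_phiMat {A : Matrix (Fin 3) (Fin 3) (LRing p)}
    (hv : Matrix.vecMul (v p) A = v p) (h1 : Matrix.mulVec A 1 = 1) :
    (phiMat p A).det = algebraMap (LRing p) (LField p) A.det := by
  have h := congrArg Matrix.det (map_mul_map_xi hv h1)
  have hx : algebraMap (LRing p) (LField p) (xi p).det ≠ 0 := fun h0 =>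
    det_xi_ne_zero p ((map_eq_zero_iff _ (IsFractionRing.injective (LRing p) (LField p))).1 h0)
  have hmap : ∀ N : Matrix (Fin 3) (Fin 3) (LRing p),
      (N.map (algebraMap (LRing p) (LField p))).det = algebraMap (LRing p) (LField p) N.det :=
    fun N => (RingHom.map_det _ N).symm
  rw [Matrix.det_mul, det_extendOne, hmap, hmap, Matrix.det_mul, map_mul, mul_comm] at h
  exact (mul_left_cancel₀ hx h).symm

lemma phiMat_eq_map {A : Matrix (Fin 3) (Fin 3) (LRing p)} {M : Matrix (Fin 2) (Fin 2) (LRing p)}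
    (h : A * xi p = xi p * extendOne M) :
    phiMat p A = M.map (algebraMap (LRing p) (LField p)) := by
  have ht := tK_ne_zero p
  have ht1 := one_add_tK_ne_zero p
  unfold phiMat gEntry
  rw [h]
  refine Matrix.ext fun i j => ?_
  fin_cases i <;> fin_cases j <;>
    simp [extendOne, Matrix.mul_apply, Fin.sum_univ_three, xi, map_t] <;>
    field_simp <;> ring

/-- A matrix over `𝔽_p[t, t⁻¹]` that is conjugate through `ξ` to `diag(M, 1)`, with `M` unitary for
`diag(1, Φ)`, lies in the formal Burau group. -/
lemma exists_formalBurau_of_mul_xi {A : Matrix (Fin 3) (Fin 3) (LRing p)}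
    {M : Matrix (Fin 2) (Fin 2) (LRing p)} (h : A * xi p = xi p * extendOne M)
    (hM : M.map (bar p) * Matrix.diagonal ![1, Phi p] * M.transpose =
      Matrix.diagonal ![1, Phi p]) :
    ∃ A' : formalBurau p, A'.val.val = A := by
  set D := extendOne M with hD
  have hDu : D.map (bar p) * Matrix.diagonal ![1, Phi p, -1] * D.transpose =
      Matrix.diagonal ![1, Phi p, -1] := by
    have h00 := congrFun (congrFun hM 0) 0
    have h01 := congrFun (congrFun hM 0) 1
    have h10 := congrFun (congrFun hM 1) 0
    have h11 := congrFun (congrFun hM 1) 1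
    simp [Matrix.mul_apply, Fin.sum_univ_two, Matrix.diagonal_apply] at h00 h01 h10 h11
    refine Matrix.ext fun i j => ?_
    fin_cases i <;> fin_cases j <;>
      simp [extendOne, Matrix.mul_apply, Fin.sum_univ_three, Matrix.diagonal_apply, *]
  have hunit : A.map (bar p) * J p * A.transpose = J p := by
    have hb : A.map (bar p) * (xi p).map (bar p) = (xi p).map (bar p) * D.map (bar p) := by
      rw [← Matrix.map_mul, h, Matrix.map_mul]
    have ht : (xi p).transpose * A.transpose = D.transpose * (xi p).transpose := by
      rw [← Matrix.transpose_mul, h, Matrix.transpose_mul]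
    have hs : Phi p • (A.map (bar p) * J p * A.transpose) = Phi p • J p := by
      calc Phi p • (A.map (bar p) * J p * A.transpose)
          = A.map (bar p) * (Phi p • J p) * A.transpose := by simp
        _ = (A.map (bar p) * (xi p).map (bar p)) * Matrix.diagonal ![1, Phi p, -1] *
              ((xi p).transpose * A.transpose) := by
            rw [Phi_smul_J]; simp only [Matrix.mul_assoc]
        _ = (xi p).map (bar p) * (D.map (bar p) * Matrix.diagonal ![1, Phi p, -1] * D.transpose) *
              (xi p).transpose := by
            rw [hb, ht]; simp only [Matrix.mul_assoc]
        _ = Phi p • J p := by rw [hDu, Phi_smul_J]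
    exact smul_right_injective _ (Phi_ne_zero p) hs
  have hv : Matrix.vecMul (v p) A = v p := by
    have h' : Matrix.vecMul (Matrix.vecMul (v p) A) (xi p) = Matrix.vecMul (v p) (xi p) := by
      rw [Matrix.vecMul_vecMul, h, ← Matrix.vecMul_vecMul]
      refine funext fun l => ?_
      fin_cases l <;>
        simp [v, xi, hD, extendOne, Matrix.vecMul, dotProduct, Fin.sum_univ_three] <;> ring
    have h'' := congrArg (fun w => Matrix.vecMul w (xi p).adjugate) h'
    simp only [Matrix.vecMul_vecMul, Matrix.mul_assoc, Matrix.mul_adjugate, Matrix.mul_smul,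
      Matrix.mul_one, Matrix.vecMul_smul, Matrix.vecMul_one] at h''
    exact smul_right_injective _ (det_xi_ne_zero p) h''
  have h1 : Matrix.mulVec A 1 = 1 := by
    refine funext fun k => ?_
    have h' := congrFun (congrFun h k) 2
    simp [Matrix.mul_apply, Fin.sum_univ_three, hD, extendOne, xi] at h'
    simp only [Matrix.mulVec, dotProduct, Fin.sum_univ_three, Pi.one_apply, mul_one]
    fin_cases k <;> simp at h' ⊢ <;> linear_combination -h'
  have hdet : IsUnit A.det := by
    have h' := congrArg Matrix.det hunit
    rw [Matrix.det_mul, Matrix.det_mul, Matrix.det_transpose] at h'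
    refine IsUnit.of_mul_eq_one (A.map (bar p)).det (mul_left_cancel₀ (det_J_ne_zero p) ?_)
    linear_combination h'
  exact ⟨⟨Matrix.GeneralLinearGroup.mk'' A hdet, hv, h1, hunit⟩, rfl⟩

/-- The congruences under which `ξ diag(M, 1) ξ⁻¹` has entries in `𝔽_p[t, t⁻¹]`: they are local
conditions at the two factors `Φ` and `1 + t` of `det ξ`. -/
lemma exists_mul_xi_eq {M : Matrix (Fin 2) (Fin 2) (LRing p)} (h00 : Phi p ∣ M 0 0 - 1)
    (h10 : Phi p ∣ M 1 0) (hsum : 1 + t p ∣ M 0 0 + M 1 0 - M 0 1 - M 1 1) :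
    ∃ A : Matrix (Fin 3) (Fin 3) (LRing p), A * xi p = xi p * extendOne M := by
  obtain ⟨a, ha⟩ := h00
  obtain ⟨b, hb⟩ := h10
  obtain ⟨c, hc⟩ := hsum
  have key := t_mul_tinv p
  have e00 : M 0 0 = 1 + Phi p * a := by linear_combination ha
  have e01 : M 0 1 = 1 + Phi p * (a + b) - M 1 1 - (1 + t p) * c := by
    linear_combination -hc + ha + hb
  -- The first column of `A ξ` is `t Φ` times the first column of `A` minus `1`, the second one
  -- is the first column of `A` plus `1 + t` times the second one minus `1`; the rows of `A` sum to
  -- `1`. Solving for `A` gives these entries.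
  refine ⟨!![1 + (1 + t p) * a, t p * M 0 1 - a, -t p * a - t p * M 0 1;
    b - tinv p * a, M 1 1 + c - a - (1 + tinv p) * b,
      1 - (b - tinv p * a) - (M 1 1 + c - a - (1 + tinv p) * b);
    -tinv p * (a + b), c - a - b, 1 + tinv p * (a + b) - (c - a - b)], ?_⟩
  refine Matrix.ext fun i j => ?_
  fin_cases i <;> fin_cases j <;>
    simp [extendOne, Matrix.mul_apply, Fin.sum_univ_three, xi, e00, e01, hb, Phi]
  all_goals grind

end Block

/-! ### The quaternionic special unitary group -/

section Unitary

open scoped QuadraticAlgebra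

variable (p : ℕ)

/-- The group of quaternionic matrices of determinant one. -/
def quaternionicSL : Subgroup SL(2, LRing p) where
  carrier := {B | IsQuaternionic p B.val}
  one_mem' := ⟨1, 0, by
    refine Matrix.ext fun i j => ?_
    fin_cases i <;> fin_cases j <;> simp⟩
  mul_mem' := fun hA hB => hA.mul hB
  inv_mem' := by
    rintro B ⟨a, b, h⟩
    refine ⟨bar p a, -b, ?_⟩
    rw [Matrix.SpecialLinearGroup.coe_inv, h, Matrix.adjugate_fin_two]
    refine Matrix.ext fun i j => ?_
    fin_cases i <;> fin_cases j <;> simp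

variable {p}

lemma quaternionicSL_apply (B : quaternionicSL p) : ∃ g₁ g₂ : LRing p,
    B.val.val = !![g₁, g₂; -Phi p * bar p g₂, bar p g₁] ∧
      g₁ * bar p g₁ + Phi p * (g₂ * bar p g₂) = 1 := by
  obtain ⟨⟨B, hdet⟩, g₁, g₂, h⟩ := B
  refine ⟨g₁, g₂, h, ?_⟩
  simp only at h
  rw [h, Matrix.det_fin_two] at hdet
  simp at hdet
  linear_combination hdet

variable (p)

/-- Reduction of the upper left entry modulo `Φ`. It is multiplicative because quaternionic matrices
become upper triangular modulo `Φ`. -/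
def reduction : quaternionicSL p →* (Eisenstein p)ˣ :=
  MonoidHom.toHomUnits
    { toFun := fun B => ev p (B.val.val 0 0)
      map_one' := by simp
      map_mul' := by
        intro A B
        obtain ⟨a, b, hA, -⟩ := quaternionicSL_apply A
        obtain ⟨c, d, hB, -⟩ := quaternionicSL_apply B
        simp [hA, hB, Matrix.mul_apply, Fin.sum_univ_two] }

lemma reduction_val (B : quaternionicSL p) :
    (reduction p B : Eisenstein p) = ev p (B.val.val 0 0) := rfl

lemma reduction_mem_normOne (B : quaternionicSL p) : reduction p B ∈ normOne p := by
  rw [mem_normOne, reduction_val]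
  apply norm_ev_eq_one
  obtain ⟨a, b, hB, h⟩ := quaternionicSL_apply B
  have h' := congrArg (ev p) h
  simpa [hB] using h'

/-- The projection of the quaternionic matrices of determinant one to `PGL(2, 𝔽_p[t, t⁻¹])`. -/
def toQuaternionicGroupOne : quaternionicSL p →* PGL(2, LRing p) :=
  Matrix.SpecialLinearGroup.toPGL.comp (quaternionicSL p).subtype

variable [Fact p.Prime]

/-- The determinant of a quaternionic matrix is invariant under the involution, hence a constant if
it is a unit; so the scalar that makes it `1` is a constant, and the rescaled matrix is again
quaternionic. -/
lemma range_toQuaternionicGroupOne : (toQuaternionicGroupOne p).range = quaternionicGroupOne p := by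
  ext M
  constructor
  · rintro ⟨B, rfl⟩
    exact ⟨⟨Matrix.SpecialLinearGroup.toGL B.val, rfl, B.property⟩,
      Matrix.SpecialLinearGroup.toGL B.val, rfl, B.val.property⟩
  · rintro ⟨⟨A, rfl, g₁, g₂, hA⟩, B, hBA, hB⟩
    obtain ⟨u, hu⟩ := Matrix.ProjGenLinGroup.mk_eq_mk_iff.1 hBA.symm
    have hval : B.val = (u : LRing p) • A.val := by
      rw [← hu]
      refine Matrix.ext fun i j => ?_
      simp [Matrix.GeneralLinearGroup.scalar, mul_comm]
    have hdet : (u : LRing p) ^ 2 * (g₁ * bar p g₁ + Phi p * (g₂ * bar p g₂)) = 1 := by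
      rw [hval, hA, Matrix.det_smul, Matrix.det_fin_two] at hB
      simp at hB
      linear_combination hB
    have hbar : bar p u ^ 2 * (g₁ * bar p g₁ + Phi p * (g₂ * bar p g₂)) = 1 := by
      have h := congrArg (bar p) hdet
      simp only [map_mul, map_add, map_pow, bar_bar, bar_Phi, map_one] at h
      linear_combination h
    have husq : bar p u ^ 2 = (u : LRing p) ^ 2 := by
      linear_combination (bar p u ^ 2) * -hdet + (u : LRing p) ^ 2 * hbar
    have hubar : bar p u = u := by
      obtain ⟨a, n, han⟩ := exists_eq_C_mul_T_of_isUnit u.isUnit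
      have ha : a ≠ 0 := by
        rintro rfl
        exact u.ne_zero (by rw [han]; simp)
      have hn : n = 0 := by
        rw [han] at husq
        have hT : bar p (LaurentPolynomial.T n) = LaurentPolynomial.T (-n) := by simp [bar]
        have hC : (LaurentPolynomial.C a : LRing p) ^ 2 ≠ 0 := by
          refine pow_ne_zero 2 fun h => ha ?_
          simpa using congrArg (fun f : LRing p => f.coeff 0) h
        rw [map_mul, bar_C, hT, mul_pow, mul_pow, LaurentPolynomial.T_pow,
          LaurentPolynomial.T_pow] at husq
        have h := congrArg LaurentPolynomial.degree (mul_left_cancel₀ hC husq)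
        rw [LaurentPolynomial.degree_T, LaurentPolynomial.degree_T, WithBot.coe_inj] at h
        push_cast at h
        lia
      rw [han, hn]
      simp
    refine ⟨⟨⟨B.val, hB⟩, u * g₁, u * g₂, ?_⟩, ?_⟩
    · change B.val = _
      rw [hval, hA]
      refine Matrix.ext fun i j => ?_
      fin_cases i <;> fin_cases j <;> simp [hubar]
      ring
    · rw [← hBA]
      change Matrix.ProjGenLinGroup.mk (Matrix.SpecialLinearGroup.toGL ⟨B.val, hB⟩) = _
      congr 1
      ext; rfl

variable {p}

/-- A unit scalar multiple `u B` is the image of a Burau matrix as soon as `u ū = 1` and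
`u g₁ ≡ 1` modulo `Φ`. -/
lemma toQuaternionicGroupOne_mem_laurentImage {B : quaternionicSL p} (u : (LRing p)ˣ)
    (hu : u * bar p u = 1) (hev : ev p u * reduction p B = 1) :
    toQuaternionicGroupOne p B ∈ laurentImage p := by
  obtain ⟨g₁, g₂, hB, hdet⟩ := quaternionicSL_apply B
  rw [reduction_val, ← map_mul, ← sub_eq_zero, ← map_one (ev p), ← map_sub, ev_eq_zero_iff] at hev
  obtain ⟨A, hA⟩ := exists_mul_xi_eq (M := (u : LRing p) • B.val.val) (by simpa using hev)
    (by
      rw [hB]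
      exact ⟨-(u * bar p g₂), by simp; ring⟩)
    (by
      obtain ⟨c, hc⟩ := one_add_t_dvd_sub_bar p g₁
      obtain ⟨d, hd⟩ := one_add_t_dvd_sub_bar p g₂
      rw [hB]
      refine ⟨u * (c - d - (1 + tinv p) * bar p g₂), ?_⟩
      simp [Phi]
      linear_combination u * hc - u * hd + u * bar p g₂ * t_mul_tinv p)
  obtain ⟨A', hA'⟩ := exists_formalBurau_of_mul_xi hA (by
    rw [hB]
    refine Matrix.ext fun i j => ?_
    fin_cases i <;> fin_cases j <;>
      simp [Matrix.mul_apply, Fin.sum_univ_two, Matrix.diagonal_apply, bar_Phi]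
    · linear_combination hdet + (g₁ * bar p g₁ + Phi p * (g₂ * bar p g₂)) * hu
    · ring
    · ring
    · linear_combination Phi p * hdet +
        Phi p * (g₁ * bar p g₁ + Phi p * (g₂ * bar p g₂)) * hu)
  refine ⟨A', ?_⟩
  rw [toQuaternionicGroupOne, phiBar, inclusion]
  simp only [MonoidHom.comp_apply, Matrix.ProjGenLinGroup.map_mk]
  symm
  rw [Matrix.ProjGenLinGroup.mk_eq_mk_iff]
  refine ⟨Units.map (algebraMap (LRing p) (LField p)).toMonoidHom u, ?_⟩
  ext i j
  rw [phi_val, hA', phiMat_eq_map hA]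
  simp [Matrix.GeneralLinearGroup.scalar, mul_comm]

/-- If `φ(A) = c B`, then `c² = det A`, so that `c` is a unit `a tᵏ` of `𝔽_p[t, t⁻¹]`. The first entry
of `A ξ` gives `c g₁ ≡ 1` modulo `Φ`, and there taking norms gives `a² = 1`. -/
lemma reduction_mem_sixthRoots {B : quaternionicSL p}
    (h : toQuaternionicGroupOne p B ∈ laurentImage p) : reduction p B ∈ sixthRoots p := by
  obtain ⟨A, hA⟩ := h
  rw [toQuaternionicGroupOne, phiBar, inclusion] at hA
  simp only [MonoidHom.comp_apply, Matrix.ProjGenLinGroup.map_mk] at hA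
  obtain ⟨c, hc⟩ := Matrix.ProjGenLinGroup.mk_eq_mk_iff.1 hA.symm
  have hinj := IsFractionRing.injective (LRing p) (LField p)
  have hphi : phiMat p A.val.val =
      (c : LField p) • B.val.val.map (algebraMap (LRing p) (LField p)) := by
    rw [← phi_val, ← hc]
    refine Matrix.ext fun i j => ?_
    simp [Matrix.GeneralLinearGroup.scalar, mul_comm]
  have hdet : (c : LField p) ^ 2 = algebraMap (LRing p) (LField p) A.val.val.det := by
    rw [← det_phiMat A.property.1 A.property.2.1, hphi, Matrix.det_smul]
    have := (RingHom.map_det (algebraMap (LRing p) (LField p)) B.val.val).symm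
    rw [B.val.property, map_one] at this
    rw [RingHom.mapMatrix_apply] at this
    rw [this]
    simp
  obtain ⟨u, hu⟩ := IsIntegrallyClosed.exists_algebraMap_eq_of_isIntegral_pow (R := LRing p)
    (K := LField p) (x := c) (n := 2) (by norm_num) (hdet ▸ isIntegral_algebraMap)
  have hunit : IsUnit u := by
    have h2 : u ^ 2 = A.val.val.det := hinj (by rw [map_pow, hu, hdet])
    rw [← isUnit_pow_iff (n := 2) (by norm_num), h2, ← Matrix.isUnit_iff_isUnit_det]
    exact A.val.isUnit
  obtain ⟨a, n, rfl⟩ := exists_eq_C_mul_T_of_isUnit hunit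
  have h00 : (A.val.val * xi p) 0 0 =
      t p * (1 + t p) * (LaurentPolynomial.C a * LaurentPolynomial.T n * B.val.val 0 0) := by
    apply hinj
    have h := congrFun (congrFun hphi 0) 0
    simp only [phiMat, gEntry, Matrix.of_apply, Matrix.cons_val', Matrix.cons_val_zero,
      Matrix.cons_val_fin_one, Matrix.smul_apply, Matrix.map_apply, smul_eq_mul, ← hu] at h
    rw [div_eq_iff (mul_ne_zero (tK_ne_zero p) (one_add_tK_ne_zero p)), ← map_mul] at h
    rw [h, ← map_t]
    simp only [← map_mul, ← map_add, ← map_one (algebraMap (LRing p) (LField p))]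
    congr 1; ring
  have hrow : (A.val.val * xi p) 0 0 = t p * Phi p * A.val.val 0 0 - 1 := by
    have h := congrFun A.property.2.1 0
    simp only [Matrix.mulVec, dotProduct, Fin.sum_univ_three, Pi.one_apply, mul_one] at h
    simp [Matrix.mul_apply, Fin.sum_univ_three, xi, Phi]
    linear_combination -h - A.val.val 0 0 * t_mul_tinv p
  have hred : (⟨a, 0⟩ : Eisenstein p) * (omegaUnit p ^ n : (Eisenstein p)ˣ) * reduction p B = 1 := by
    have h := congrArg (ev p) (h00.symm.trans hrow)
    simp only [map_mul, map_sub, map_add, map_one, ev_Phi, ev_C, ev_T, ev_t] at h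
    have hw : (⟨0, 1⟩ : Eisenstein p) * (1 + ⟨0, 1⟩) = -1 := by ext <;> simp
    rw [reduction_val]
    linear_combination -h + (⟨a, 0⟩ * ((omegaUnit p ^ n : (Eisenstein p)ˣ) : Eisenstein p) *
      ev p (B.val.val 0 0)) * hw
  have hωn : omegaUnit p ^ n ∈ sixthRoots p := zpow_mem (omegaUnit_mem_sixthRoots p) n
  have ha : a * a = 1 := by
    have h := congrArg QuadraticAlgebra.norm hred
    rw [map_mul, map_mul, mem_normOne.1 (reduction_mem_normOne p B),
      mem_normOne.1 (sixthRoots_le_normOne p hωn), map_one] at h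
    simpa [QuadraticAlgebra.norm_def] using h
  have hr : ∀ s : (Eisenstein p)ˣ, s ∈ sixthRoots p → (s : Eisenstein p) = ⟨a, 0⟩ →
      reduction p B ∈ sixthRoots p := by
    intro s hs hsa
    have e : s * omegaUnit p ^ n * reduction p B = 1 := by
      ext1
      rw [Units.val_mul, Units.val_mul, hsa, hred, Units.val_one]
    rw [eq_inv_of_mul_eq_one_right e]
    exact inv_mem (mul_mem hs hωn)
  rcases mul_self_eq_one_iff.1 ha with rfl | rfl
  · exact hr 1 (one_mem _) (by ext <;> simp)
  · exact hr (-1) (neg_one_mem_sixthRoots p) (by ext <;> simp)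

/-- The Laurent image inside the quaternionic group of determinant one consists of the elements with
reduction in `{± ωᵏ}`. -/
lemma toQuaternionicGroupOne_mem_laurentImage_iff {B : quaternionicSL p} :
    toQuaternionicGroupOne p B ∈ laurentImage p ↔ reduction p B ∈ sixthRoots p := by
  refine ⟨reduction_mem_sixthRoots, fun h => ?_⟩
  obtain ⟨j, hj⟩ := inv_mem h
  simp only at hj
  -- the scalar `(-t)ʲ` lifts the inverse `(-ω)ʲ` of the reduction
  let τ : (LRing p)ˣ := ⟨-t p, -tinv p, by linear_combination t_mul_tinv p,
    by linear_combination t_mul_tinv p⟩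
  refine toQuaternionicGroupOne_mem_laurentImage (τ ^ j) ?_ ?_
  · have h1 : Units.map (bar p).toMonoidHom τ = τ⁻¹ := by
      ext1
      change bar p (-t p) = -tinv p
      simp
    have h2 : bar p ((τ ^ j : (LRing p)ˣ) : LRing p) =
        (Units.map (bar p).toMonoidHom (τ ^ j) : (LRing p)ˣ) := rfl
    rw [h2, map_zpow, h1, ← Units.val_mul, inv_zpow, mul_inv_cancel, Units.val_one]
  · have h1 : Units.map (ev p).toMonoidHom τ = -omegaUnit p := by
      ext1
      change ev p (-t p) = _
      simp [omegaUnit]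
    have h2 : ev p ((τ ^ j : (LRing p)ˣ) : LRing p) =
        (Units.map (ev p).toMonoidHom (τ ^ j) : (Eisenstein p)ˣ) := rfl
    rw [h2, map_zpow, h1, hj, ← Units.val_mul, inv_mul_cancel, Units.val_one]

variable (p)

lemma relIndex_laurentImageOne : (laurentImageOne p).relIndex (quaternionicGroupOne p) =
    (sixthRoots p).relIndex (reduction p).range := by
  rw [laurentImageOne, Subgroup.inf_relIndex_right, ← range_toQuaternionicGroupOne,
    ← Subgroup.index_comap, ← Subgroup.index_comap]
  congr 1
  ext B
  exact toQuaternionicGroupOne_mem_laurentImage_iff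

end Unitary

/-! ### The norm-one group of `𝔽_p[ω]` -/

section NormOne

open scoped QuadraticAlgebra

variable {p : ℕ}

lemma mem_sixthRoots_iff {x : (Eisenstein p)ˣ} : x ∈ sixthRoots p ↔
    (x : Eisenstein p) ∈ ([⟨1, 0⟩, ⟨0, -1⟩, ⟨-1, -1⟩, ⟨-1, 0⟩, ⟨0, 1⟩, ⟨1, 1⟩] :
      List (Eisenstein p)) := by
  have h6 : (-omegaUnit p) ^ 6 = 1 := by ext <;> simp [omegaUnit, pow_succ]
  constructor
  · rintro ⟨n, rfl⟩
    simp only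
    rw [zpow_eq_zpow_emod' n h6]
    obtain ⟨k, hk⟩ := Int.eq_ofNat_of_zero_le (Int.emod_nonneg n (b := (6 : ℕ)) (by norm_num))
    have hk6 : k < 6 := by
      have := Int.emod_lt_of_pos n (b := (6 : ℕ)) (by norm_num)
      lia
    rw [hk, zpow_natCast]
    interval_cases k <;> simp [omegaUnit, pow_succ, QuadraticAlgebra.ext_iff]
  · have hpow : ∀ k : ℕ, (x : Eisenstein p) = ((-omegaUnit p) ^ k : (Eisenstein p)ˣ) →
        x ∈ sixthRoots p := by
      intro k hk
      rw [Units.ext hk]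
      exact pow_mem (Subgroup.mem_zpowers _) k
    intro h
    simp only [List.mem_cons, List.not_mem_nil, or_false] at h
    rcases h with h | h | h | h | h | h
    · exact hpow 0 (by rw [h]; ext <;> simp)
    · exact hpow 1 (by rw [h]; ext <;> simp [omegaUnit])
    · exact hpow 2 (by rw [h]; ext <;> simp [omegaUnit, pow_succ])
    · exact hpow 3 (by rw [h]; ext <;> simp [omegaUnit, pow_succ])
    · exact hpow 4 (by rw [h]; ext <;> simp [omegaUnit, pow_succ])
    · exact hpow 5 (by rw [h]; ext <;> simp [omegaUnit, pow_succ])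

variable (p) [Fact p.Prime]

instance : Finite (Eisenstein p) := Finite.of_equiv _ (QuadraticAlgebra.equivProd _ _).symm

lemma normOne_le_sixthRoots (hp : p ≤ 7) : normOne p ≤ sixthRoots p := by
  intro x hx
  rw [mem_normOne] at hx
  rw [mem_sixthRoots_iff]
  generalize (x : Eisenstein p) = z at hx ⊢
  obtain ⟨a, b⟩ := z
  rw [QuadraticAlgebra.norm_def] at hx
  simp only [QuadraticAlgebra.ext_iff, List.mem_cons, List.not_mem_nil, or_false] at hx ⊢
  have hprime : p.Prime := Fact.out
  interval_cases p <;> first | (exfalso; revert hprime; norm_num; done) | (revert a b; decide)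

variable {p}

lemma natCast_ne_zero_of_lt {n : ℕ} (h0 : 0 < n) (hn : n < p) : (n : ZMod p) ≠ 0 := by
  rw [Ne, ZMod.natCast_eq_zero_iff]
  exact Nat.not_dvd_of_pos_of_lt h0 hn

lemma card_sixthRoots (hp : 3 < p) : Nat.card (sixthRoots p) = 6 := by
  have h2 : (2 : ZMod p) ≠ 0 := by exact_mod_cast natCast_ne_zero_of_lt (n := 2) (by simp) (by lia)
  have h1 : (-1 : ZMod p) ≠ 1 := fun h => h2 (by linear_combination -h)
  rw [sixthRoots, Nat.card_zpowers, orderOf_eq_iff (by norm_num)]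
  constructor
  · ext <;> simp [omegaUnit, pow_succ]
  · intro m hm hm0
    interval_cases m <;>
      simp [Units.ext_iff, QuadraticAlgebra.ext_iff, omegaUnit, pow_succ, h1]

/-- The points of the conic `a² - ab + b² = 1` other than those with `a = 1` lie on the lines
`b = m (a - 1)` through `(1, 0)`; each slope `m` gives one point, and none if `m² - m + 1 = 0`.
The slope `m = 2` is that of the tangent at `(1, 0)`, and the vertical line gives `(1, 1)`. -/
lemma card_normOne_le_card_slopes (hp : 3 < p) :
    Nat.card (normOne p) ≤ (Finset.univ.filter fun m : ZMod p => m ^ 2 - m + 1 ≠ 0).card + 1 := by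
  classical
  have h3 : (3 : ZMod p) ≠ 0 := by exact_mod_cast natCast_ne_zero_of_lt (n := 3) (by simp) hp
  set S := Finset.univ.filter fun m : ZMod p => m ^ 2 - m + 1 ≠ 0 with hS
  let F : Option (ZMod p) → ZMod p × ZMod p := fun o => o.elim (1, 1) fun m =>
    ((m ^ 2 - 1) / (m ^ 2 - m + 1), m * ((m ^ 2 - 1) / (m ^ 2 - m + 1) - 1))
  let T := Finset.univ.filter fun x : ZMod p × ZMod p => x.1 ^ 2 - x.1 * x.2 + x.2 ^ 2 = 1
  have hTS : T ⊆ (Finset.insertNone S).image F := by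
    rintro ⟨a, b⟩ hab
    have hab : a ^ 2 - a * b + b ^ 2 = 1 := (Finset.mem_filter.1 hab).2
    rw [Finset.mem_image]
    by_cases ha : a = 1
    · subst ha
      have hb : b * (b - 1) = 0 := by linear_combination hab
      rcases mul_eq_zero.1 hb with rfl | hb
      · have e : (2 ^ 2 - 2 + 1 : ZMod p) = 3 := by norm_num
        have e' : (2 ^ 2 - 1 : ZMod p) = 3 := by norm_num
        refine ⟨some 2, by simpa [hS, e] using h3, ?_⟩
        simp only [F, Option.elim, e, e', div_self h3, sub_self, mul_zero]
      · exact ⟨none, by simp, by simp [F]; linear_combination -hb⟩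
    · have ha' : a - 1 ≠ 0 := sub_ne_zero.2 ha
      set m := b / (a - 1) with hm
      have hb : b = m * (a - 1) := by rw [hm]; field_simp
      have h1 : a * (m ^ 2 - m + 1) = m ^ 2 - 1 := by
        apply mul_left_cancel₀ ha'
        rw [hb] at hab
        linear_combination hab
      have h2 : m ^ 2 - m + 1 ≠ 0 := by
        intro h0
        rw [h0, mul_zero] at h1
        exact h3 (by linear_combination (m + 2) * h0 + (m + 1) * h1)
      have hma : (m ^ 2 - 1) / (m ^ 2 - m + 1) = a := by rw [← h1, mul_div_cancel_right₀ _ h2]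
      refine ⟨some m, by simpa [hS] using h2, ?_⟩
      simp only [F, Option.elim, hma, ← hb]
  have hcard : T.card ≤ S.card + 1 := by
    calc T.card ≤ ((Finset.insertNone S).image F).card := Finset.card_le_card hTS
      _ ≤ (Finset.insertNone S).card := Finset.card_image_le
      _ = S.card + 1 := Finset.card_insertNone S
  refine le_trans ?_ hcard
  have hT : ∀ x : normOne p, ((x.val : Eisenstein p).re, (x.val : Eisenstein p).im) ∈ T := by
    intro x
    have hx := mem_normOne.1 x.property
    rw [QuadraticAlgebra.norm_def] at hx
    refine Finset.mem_filter.2 ⟨Finset.mem_univ _, ?_⟩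
    linear_combination hx
  have hinj : Function.Injective fun x : normOne p => (⟨_, hT x⟩ : T) := by
    intro x y hxy
    simp only [Subtype.mk.injEq, Prod.mk.injEq] at hxy
    exact Subtype.ext (Units.ext (QuadraticAlgebra.ext hxy.1 hxy.2))
  simpa using Nat.card_le_card_of_injective _ hinj

lemma card_normOne_le (hp : 3 < p) :
    (Nat.card (normOne p) : ℤ) ≤ p - legendreSym p (-3) := by
  have h2 : (2 : ZMod p) ≠ 0 := by exact_mod_cast natCast_ne_zero_of_lt (n := 2) (by simp) (by lia)
  have h3 : (3 : ZMod p) ≠ 0 := by exact_mod_cast natCast_ne_zero_of_lt (n := 3) (by simp) hp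
  have h30 : ((-3 : ℤ) : ZMod p) ≠ 0 := by simpa using h3
  have hle := card_normOne_le_card_slopes hp
  set S := Finset.univ.filter fun m : ZMod p => m ^ 2 - m + 1 ≠ 0 with hS
  have hSp : S.card ≤ p := by simpa [ZMod.card] using Finset.card_le_univ S
  by_cases hsq : IsSquare ((-3 : ℤ) : ZMod p)
  · rw [(legendreSym.eq_one_iff p h30).2 hsq]
    obtain ⟨s, hs⟩ := hsq
    push_cast at hs
    have hs0 : s ≠ 0 := by
      rintro rfl
      exact h3 (by linear_combination -hs)
    -- two slopes, the roots of `m² - m + 1`, are excluded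
    have hne : (1 + s) / 2 ≠ (1 - s) / 2 := by
      intro h
      field_simp at h
      exact mul_ne_zero h2 hs0 (by linear_combination h)
    have hsub : S ⊆ Finset.univ \ {(1 + s) / 2, (1 - s) / 2} := by
      intro m hm
      simp only [Finset.mem_sdiff, Finset.mem_univ, true_and, Finset.mem_insert,
        Finset.mem_singleton]
      refine fun h => (Finset.mem_filter.1 hm).2 ?_
      rcases h with rfl | rfl <;> field_simp <;> linear_combination -hs
    have hcard := Finset.card_le_card hsub
    rw [Finset.card_sdiff_of_subset (Finset.subset_univ _), Finset.card_univ, ZMod.card,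
      Finset.card_pair hne] at hcard
    lia
  · rw [(legendreSym.eq_neg_one_iff p).2 hsq]
    lia

lemma relIndex_sixthRoots_normOne_mul (hp : 3 < p) :
    (sixthRoots p).relIndex (normOne p) * 6 = Nat.card (normOne p) := by
  rw [← card_sixthRoots hp, ← Subgroup.relIndex_bot_left, ← Subgroup.relIndex_bot_left, mul_comm,
    Subgroup.relIndex_mul_relIndex _ _ _ bot_le (sixthRoots_le_normOne p)]

end NormOne

/-! ### The index -/

section Index

variable {p : ℕ} [Fact p.Prime]

open scoped QuadraticAlgebra

lemma relIndex_sixthRoots_ne_zero (K : Subgroup (Eisenstein p)ˣ) :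
    (sixthRoots p).relIndex K ≠ 0 :=
  Subgroup.index_ne_zero_of_finite

/-- For `p > 7` the solution `g₁ = (4 - 4t - t²)/7`, `g₂ = 2(1 + t)/7` of `g₁ ḡ₁ + Φ g₂ ḡ₂ = 1` has
reduction `(5 - 3ω)/7`, which is not `± ωᵏ`. -/
lemma exists_reduction_notMem_sixthRoots (hp : 7 < p) :
    ∃ B : quaternionicSL p, reduction p B ∉ sixthRoots p := by
  have hnat : ∀ n : ℕ, 0 < n → n ≤ 8 → (n : ZMod p) ≠ 0 := by
    intro n hn0 hn
    refine natCast_ne_zero_of_lt hn0 (lt_of_le_of_ne (by lia) ?_)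
    rintro rfl
    have hprime : Nat.Prime n := Fact.out
    have : n = 8 := by lia
    subst this
    norm_num at hprime
  have h3 : (3 : ZMod p) ≠ 0 := by exact_mod_cast hnat 3 (by norm_num) (by norm_num)
  have h5 : (5 : ZMod p) ≠ 0 := by exact_mod_cast hnat 5 (by norm_num) (by norm_num)
  have h7 : (7 : ZMod p) ≠ 0 := by exact_mod_cast hnat 7 (by norm_num) (by norm_num)
  have h8 : (8 : ZMod p) ≠ 0 := by exact_mod_cast hnat 8 (by norm_num) (by norm_num)
  let c : LRing p := LaurentPolynomial.C (7⁻¹ : ZMod p)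
  have hbc : bar p c = c := bar_C p _
  have hc : 7 * c = 1 := by
    have : (LaurentPolynomial.C (7 : ZMod p) : LRing p) = 7 := map_ofNat _ 7
    rw [← this, ← map_mul, mul_inv_cancel₀ h7, map_one]
  let M : Matrix (Fin 2) (Fin 2) (LRing p) :=
    !![c * (4 - 4 * t p - t p ^ 2), c * (2 * (1 + t p));
      -Phi p * bar p (c * (2 * (1 + t p))), bar p (c * (4 - 4 * t p - t p ^ 2))]
  have hdet : M.det = 1 := by
    have key := t_mul_tinv p
    rw [Matrix.det_fin_two]
    simp only [M, Matrix.of_apply, Matrix.cons_val', Matrix.cons_val_zero, Matrix.cons_val_one,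
      Matrix.cons_val_fin_one, map_mul, map_sub, map_add, map_pow, map_one, map_ofNat, bar_t, hbc,
      Phi]
    grind
  refine ⟨⟨⟨M, hdet⟩, _, _, rfl⟩, fun h => ?_⟩
  rw [mem_sixthRoots_iff] at h
  have hred : (reduction p ⟨⟨M, hdet⟩, _, _, rfl⟩ : Eisenstein p) = ⟨7⁻¹ * 5, 7⁻¹ * -3⟩ := by
    rw [reduction_val]
    simp only [M, c, Matrix.of_apply, Matrix.cons_val', Matrix.cons_val_zero,
      Matrix.cons_val_fin_one, map_mul, map_sub, map_pow, map_ofNat, ev_C, ev_t]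
    ext <;> simp [pow_two] <;> norm_num
  rw [hred] at h
  simp only [QuadraticAlgebra.ext_iff, List.mem_cons, List.not_mem_nil, or_false] at h
  -- The constant coefficient `5/7` and the coefficient `-3/7` of `ω` are nonzero, and they differ as `8 ≠ 0`.
  rcases h with h | h | h | h | h | h <;> obtain ⟨ha, hb⟩ := h <;> field_simp at ha hb <;> grind

end Index

end BurauMod

end

theorem theorem2p17 (p : ℕ) [Fact p.Prime] :
    (p ≤ 7 → BurauMod.quaternionicGroupOne p = BurauMod.laurentImageOne p) ∧
    (7 < p →
      2 ≤ (BurauMod.laurentImageOne p).relIndex (BurauMod.quaternionicGroupOne p) ∧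
      ((BurauMod.laurentImageOne p).relIndex (BurauMod.quaternionicGroupOne p) : ℚ) ≤
        ((p : ℚ) - (legendreSym p (-3) : ℚ)) / 6) := by
  have hrange : (BurauMod.reduction p).range ≤ BurauMod.normOne p := by
    rintro _ ⟨B, rfl⟩
    exact BurauMod.reduction_mem_normOne p B
  have hindex := BurauMod.relIndex_laurentImageOne p
  refine ⟨fun hp => ?_, fun hp => ⟨?_, ?_⟩⟩
  · refine le_antisymm ?_ inf_le_right
    rw [← Subgroup.relIndex_eq_one, hindex, Subgroup.relIndex_eq_one]
    exact hrange.trans (BurauMod.normOne_le_sixthRoots p hp)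
  · have h0 := BurauMod.relIndex_sixthRoots_ne_zero (BurauMod.reduction p).range
    have h1 : (BurauMod.sixthRoots p).relIndex (BurauMod.reduction p).range ≠ 1 := by
      rw [Ne, Subgroup.relIndex_eq_one]
      obtain ⟨B, hB⟩ := BurauMod.exists_reduction_notMem_sixthRoots hp
      exact fun h => hB (h ⟨B, rfl⟩)
    lia
  · rw [hindex, le_div_iff₀ (by norm_num)]
    have hle := Subgroup.relIndex_le_of_le_right hrange
      (BurauMod.relIndex_sixthRoots_ne_zero (BurauMod.normOne p))
    have hmul := BurauMod.relIndex_sixthRoots_normOne_mul (p := p) (by lia)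
    have hcard := BurauMod.card_normOne_le (p := p) (by lia)
    have h : ((BurauMod.sixthRoots p).relIndex (BurauMod.reduction p).range : ℤ) * 6 ≤
        p - legendreSym p (-3) := by lia
    exact_mod_cast h
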